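/- Let $n$ be a positive integer and let $0<r<n$ be a real number. For $H\subset\mathbb{R}^n$ let $\mathcal{H}^r(H)$ denote its $r$-dimensional Hausdorff (outer) measure, $$\mathcal{H}^r(H)=\lim_{\delta\to0+}\inf\Big\{\sum_{k\in\omega}(\operatorname{diam}A_k)^r : H\subset\bigcup_{k\in\omega}A_k,\ \operatorname{diam}A_k\le\delta\text{ for all }k\Big\}.$$ Let $\mathcal{N}^r_n=\{H\subset\mathbb{R}^n:\mathcal{H}^r(H)=0\}$, and let $\mathcal{I}^r_{n,\sigma\text{-fin}}$ be the family of all $H\subset\mathbb{R}^n$ for which there are sets $H_k\subset\mathbb{R}^n$ ($k\in\omega$) with $\bigcup_{k}H_k=H$ and $\mathcal{H}^r(H_k)<\infty$ for every $k$. For a family $\mathcal{I}$ of subsets of a set $X$ put $$\operatorname{add}(\mathcal I)=\min\{|\mathcal F|:\mathcal F\subset\mathcal I,\ \textstyle\bigcup\mathcal F\notin\mathcal I\},\qquad \operatorname{cov}(\mathcal I)=\min\{|\mathcal F|:\mathcal F\subset\mathcal I,\ \textstyle\bigcup\mathcal F=X\},$$ $$\operatorname{non}(\mathcal I)=\min\{|A|:A\subset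 X,\ A\notin\mathcal I\},\qquad \operatorname{cof}(\mathcal I)=\min\{|\mathcal F|:\mathcal F\subset\mathcal I,\ \forall A\in\mathcal I\ \exists B\in\mathcal F\ A\subset B\}.$$ Then, in ZFC, $$\operatorname{add}(\mathcal{I}^r_{n,\sigma\text{-fin}})=\omega_1,\quad \operatorname{cov}(\mathcal{I}^r_{n,\sigma\text{-fin}})=\operatorname{cov}(\mathcal{N}^r_n),\quad \operatorname{non}(\mathcal{I}^r_{n,\sigma\text{-fin}})=\operatorname{non}(\mathcal{N}^r_n),\quad \operatorname{cof}(\mathcal{I}^r_{n,\sigma\text{-fin}})=\mathfrak{c}.$$ -/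

import Mathlib

open Set MeasureTheory
open scoped ENNReal Cardinal MeasureTheory

namespace HausdorffInvariants

/-- The additivity of `I`: the least cardinality of a family of members of `I`
whose union is not in `I`. -/
noncomputable def add {X : Type} (I : Set (Set X)) : Cardinal.{0} :=
  sInf {κ | ∃ F : Set (Set X), F ⊆ I ∧ ⋃₀ F ∉ I ∧ #F = κ}

/-- The covering number of `I`: the least cardinality of a family of members of `I`
whose union is the whole space. -/
noncomputable def cov {X : Type} (I : Set (Set X)) : Cardinal.{0} :=
  sInf {κ | ∃ F : Set (Set X), F ⊆ I ∧ ⋃₀ F = univ ∧ #F = κ}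

/-- The uniformity of `I`: the least cardinality of a set that is not in `I`. -/
noncomputable def non {X : Type} (I : Set (Set X)) : Cardinal.{0} :=
  sInf {κ | ∃ A : Set X, A ∉ I ∧ #A = κ}

/-- The cofinality of `I`: the least cardinality of a subfamily of `I` such that every member
of `I` is contained in a member of the subfamily. -/
noncomputable def cof {X : Type} (I : Set (Set X)) : Cardinal.{0} :=
  Order.cof I

/-- The sets of `r`-dimensional Hausdorff measure zero in `ℝⁿ`. The value of `μH[r]` at an arbitrary
(possibly non-measurable) set is its `r`-dimensional Hausdorff outer measure. -/
def nullIdeal (n : ℕ) (r : ℝ) : Set (Set (EuclideanSpace ℝ (Fin n))) :=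
  {H | μH[r] H = 0}

/-- The sets of `σ`-finite `r`-dimensional Hausdorff measure in `ℝⁿ`. The sets `S k` need not be
measurable. -/
def sigmaFinIdeal (n : ℕ) (r : ℝ) : Set (Set (EuclideanSpace ℝ (Fin n))) :=
  {H | ∃ S : ℕ → Set (EuclideanSpace ℝ (Fin n)), ⋃ k, S k = H ∧ ∀ k, μH[r] (S k) < ∞}

theorem nullIdeal_subset_sigmaFinIdeal (n : ℕ) (r : ℝ) :
    nullIdeal n r ⊆ sigmaFinIdeal n r := fun H hH =>
  ⟨fun _ => H, iUnion_const H, fun _ => by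
    have h : μH[r] H = 0 := hH
    rw [h]; exact ENNReal.zero_lt_top⟩

/-- Singletons are null, so the families in `cov` exist. -/
theorem singleton_mem_nullIdeal (n : ℕ) {r : ℝ} (hr : 0 < r) (x : EuclideanSpace ℝ (Fin n)) :
    {x} ∈ nullIdeal n r := by
  have := Measure.nullSingletonClass_hausdorff (X := EuclideanSpace ℝ (Fin n)) hr
  exact measure_singleton x

/-- The whole space is not in the ideals, so the sets in `non` exist. -/
theorem univ_notMem_sigmaFinIdeal {n : ℕ} {r : ℝ} (hrn : r < n) :
    univ ∉ sigmaFinIdeal n r := by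
  rintro ⟨S, hS, hfin⟩
  have h0 : ∀ k, μH[(n : ℝ)] (S k) = 0 := fun k =>
    (Measure.hausdorffMeasure_zero_or_top hrn (S k)).resolve_right (hfin k).ne
  have h1 : μH[(n : ℝ)] (univ : Set (EuclideanSpace ℝ (Fin n))) = 0 := by
    rw [← hS]; exact measure_iUnion_null h0
  have h2 : (μH[(n : ℝ)] : Measure (EuclideanSpace ℝ (Fin n))).IsAddHaarMeasure := by
    simpa using isAddHaarMeasure_hausdorffMeasure (E := EuclideanSpace ℝ (Fin n))
  exact (isOpen_univ.measure_pos (μH[(n : ℝ)]) univ_nonempty).ne' h1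

end HausdorffInvariants

namespace HausdorffInvariants

open Filter Topology

/-! Two facts carry the proof. First, there are continuum many disjoint compact self-similar Cantor
sets of positive finite `μH[r]` measure, indexed by binary sequences
(`exists_disjoint_family_hausdorffMeasure_pos_finite`). A σ-finite set contains only countably many
of them (`countable_setOf_subset`), so the union of any `ℵ₁` of them leaves the ideal, and a cofinal
family needs `𝔠` members; Borel hulls give the upper bound for `cof`.

Second, `μH[r]` restricted to a set `B` of finite measure is finite and atomless, so some Borel map
`f` pulls Lebesgue null sets back to null sets of this restriction
(`exists_quasiMeasurePreserving_restrict`). As `r < n`, members of the σ-finite ideal are Lebesgue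
null, hence their preimages are `μH[r]`-null inside `B`. This turns σ-finite covers into null covers
and non-null sets into non-σ-finite ones. -/

/-! ### Power series with bounded coefficients. -/

theorem summable_mul_pow_of_abs_le {c : ℕ → ℝ} {D s : ℝ} (hc : ∀ i, |c i| ≤ D)
    (hs0 : 0 ≤ s) (hs1 : s < 1) : Summable fun i => c i * s ^ i := by
  refine Summable.of_norm_bounded (g := fun i => D * s ^ i)
    ((summable_geometric_of_lt_one hs0 hs1).mul_left D) fun i => ?_
  rw [Real.norm_eq_abs, abs_mul, abs_of_nonneg (pow_nonneg hs0 i)]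
  exact mul_le_mul_of_nonneg_right (hc i) (pow_nonneg hs0 i)

theorem abs_tsum_mul_pow_le {c : ℕ → ℝ} {D s : ℝ} {k : ℕ} (hc : ∀ i, |c i| ≤ D)
    (h0 : ∀ i < k, c i = 0) (hs0 : 0 ≤ s) (hs2 : s ≤ 1 / 2) :
    |∑' i, c i * s ^ i| ≤ 2 * D * s ^ k := by
  have hs1 : s < 1 := by linarith
  have hD : 0 ≤ D := (abs_nonneg _).trans (hc 0)
  rw [← (summable_mul_pow_of_abs_le hc hs0 hs1).sum_add_tsum_nat_add k,
    Finset.sum_eq_zero fun i hi => by rw [h0 i (Finset.mem_range.1 hi), zero_mul], zero_add]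
  have hg := ((hasSum_geometric_of_lt_one hs0 hs1).mul_left (D * s ^ k))
  rw [← Real.norm_eq_abs]
  refine (tsum_of_norm_bounded hg fun i => ?_).trans ?_
  · rw [Real.norm_eq_abs, abs_mul, abs_of_nonneg (pow_nonneg hs0 _), pow_add,
      mul_assoc D, mul_comm (s ^ k)]
    exact mul_le_mul_of_nonneg_right (hc _) (by positivity)
  · have h2 : (1 - s)⁻¹ ≤ 2 := by
      rw [inv_le_comm₀ (by linarith) two_pos]; linarith
    calc D * s ^ k * (1 - s)⁻¹ ≤ D * s ^ k * 2 := by gcongr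
      _ = 2 * D * s ^ k := by ring

/-- The leading term dominates: the tail is at most `2 * D * s ^ (k + 1) ≤ s ^ k / 2`. -/
theorem le_abs_tsum_mul_pow {c : ℕ → ℝ} {D s : ℝ} {k : ℕ} (hc : ∀ i, |c i| ≤ D)
    (h0 : ∀ i < k, c i = 0) (hk : 1 ≤ |c k|) (hs0 : 0 ≤ s) (hs : 4 * D * s ≤ 1)
    (hs2 : s ≤ 1 / 2) : s ^ k / 2 ≤ |∑' i, c i * s ^ i| := by
  have hs1 : s < 1 := by linarith
  have hsum := summable_mul_pow_of_abs_le hc hs0 hs1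
  have hc' : ∀ i, |if i = k then 0 else c i| ≤ D := fun i => by
    split_ifs
    · simpa using (abs_nonneg _).trans (hc 0)
    · exact hc i
  have htail := abs_tsum_mul_pow_le (k := k + 1) hc' (fun i hi => by
    split_ifs with h
    · rfl
    · exact h0 i (by omega)) hs0 hs2
  have hsplit : ∑' i, c i * s ^ i = c k * s ^ k + ∑' i, (if i = k then 0 else c i) * s ^ i := by
    rw [hsum.tsum_eq_add_tsum_ite k]
    congr 1
    refine tsum_congr fun i => ?_
    split_ifs <;> simp
  rw [hsplit]
  have h1 : |c k * s ^ k| ≥ s ^ k := by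
    rw [abs_mul, abs_of_nonneg (pow_nonneg hs0 k)]
    exact le_mul_of_one_le_left (pow_nonneg hs0 k) hk
  have h2 : 2 * D * s ^ (k + 1) ≤ s ^ k / 2 := by
    rw [pow_succ]
    nlinarith [pow_nonneg hs0 k]
  have h3 := abs_sub_abs_le_abs_add (c k * s ^ k)
    (∑' i, (if i = k then 0 else c i) * s ^ i)
  linarith

/-- The point whose `j`-th coordinate has the expansion in powers of `s` with digits
`2 * w k j + z k`. -/
noncomputable def cantorPoint {n M : ℕ} (s : ℝ) (w : ℕ → Fin n → Fin M) (z : ℕ → Bool) :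
    EuclideanSpace ℝ (Fin n) :=
  WithLp.toLp 2 fun j => ∑' k, (2 * (w k j : ℝ) + ((z k).toNat : ℝ)) * s ^ k

/-! ### Disjoint Cantor sets of positive finite measure. -/

section cantorPoint

variable {n M : ℕ} {s : ℝ}

theorem digit_nonneg (a : Fin M) (b : Bool) : 0 ≤ 2 * (a : ℝ) + (b.toNat : ℝ) := by positivity

theorem digit_le (a : Fin M) (b : Bool) : 2 * (a : ℝ) + (b.toNat : ℝ) ≤ 2 * M := by
  have h1 : (a : ℝ) + 1 ≤ M := by exact_mod_cast a.2
  have h2 : (b.toNat : ℝ) ≤ 1 := by exact_mod_cast b.toNat_le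
  linarith

theorem abs_digit_le (a : Fin M) (b : Bool) : |2 * (a : ℝ) + (b.toNat : ℝ)| ≤ 2 * M := by
  rw [abs_of_nonneg (digit_nonneg a b)]
  exact digit_le a b

theorem abs_digit_sub_le (a a' : Fin M) (b b' : Bool) :
    |2 * (a : ℝ) + (b.toNat : ℝ) - (2 * (a' : ℝ) + (b'.toNat : ℝ))| ≤ 2 * M := by
  rw [abs_le]
  constructor <;> linarith [digit_nonneg a b, digit_nonneg a' b', digit_le a b, digit_le a' b']

/-- The difference is an integer: odd if the parities `b`, `b'` differ, otherwise twice `a - a'`. -/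
theorem one_le_abs_digit_sub {a a' : Fin M} {b b' : Bool} (h : a ≠ a' ∨ b ≠ b') :
    1 ≤ |2 * (a : ℝ) + (b.toNat : ℝ) - (2 * (a' : ℝ) + (b'.toNat : ℝ))| := by
  have key : (1 : ℤ) ≤ |2 * (a : ℤ) + (b.toNat : ℤ) - (2 * (a' : ℤ) + (b'.toNat : ℤ))| := by
    apply Int.one_le_abs
    rw [Fin.ne_iff_vne] at h
    revert h
    cases b <;> cases b' <;> simp <;> omega
  exact_mod_cast key

theorem cantorPoint_sub_apply (hs0 : 0 ≤ s) (hs2 : s ≤ 1 / 2) (w w' : ℕ → Fin n → Fin M)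
    (z z' : ℕ → Bool) (j : Fin n) : (cantorPoint s w z - cantorPoint s w' z') j =
      ∑' k, (2 * (w k j : ℝ) + ((z k).toNat : ℝ) - (2 * (w' k j : ℝ) + ((z' k).toNat : ℝ))) *
        s ^ k := by
  have hs1 : s < 1 := by linarith
  have h := (summable_mul_pow_of_abs_le (fun k => abs_digit_le (w k j) (z k)) hs0 hs1).tsum_sub
    (summable_mul_pow_of_abs_le (fun k => abs_digit_le (w' k j) (z' k)) hs0 hs1)
  simp only [cantorPoint, PiLp.sub_apply, ← h, sub_mul]

theorem dist_cantorPoint_le (hs0 : 0 ≤ s) (hs2 : s ≤ 1 / 2) {w w' : ℕ → Fin n → Fin M}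
    {z : ℕ → Bool} {k : ℕ} (h : ∀ i < k, w i = w' i) :
    dist (cantorPoint s w z) (cantorPoint s w' z) ≤ n * (4 * M) * s ^ k := by
  rw [dist_eq_norm]
  calc ‖cantorPoint s w z - cantorPoint s w' z‖
      ≤ ∑ j, ‖(cantorPoint s w z - cantorPoint s w' z) j‖ := by
        rw [EuclideanSpace.norm_eq]
        refine Real.sqrt_le_iff.2 ⟨by positivity, ?_⟩
        exact Finset.sum_sq_le_sq_sum_of_nonneg fun _ _ => norm_nonneg _
    _ ≤ ∑ _j : Fin n, 4 * M * s ^ k := by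
        refine Finset.sum_le_sum fun j _ => ?_
        rw [cantorPoint_sub_apply hs0 hs2, Real.norm_eq_abs]
        refine (abs_tsum_mul_pow_le (k := k) (fun i => abs_digit_sub_le _ _ _ _)
          (fun i hi => by rw [h i hi, sub_self]) hs0 hs2).trans (le_of_eq (by ring))
    _ = n * (4 * M) * s ^ k := by simp; ring

theorem le_dist_cantorPoint (hs0 : 0 ≤ s) (hs2 : s ≤ 1 / 2) (hs : 8 * M * s ≤ 1)
    {w w' : ℕ → Fin n → Fin M} {z z' : ℕ → Bool} {k : ℕ} (hw : ∀ i < k, w i = w' i)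
    (hz : ∀ i < k, z i = z' i) {j : Fin n} (h : w k j ≠ w' k j ∨ z k ≠ z' k) :
    s ^ k / 2 ≤ dist (cantorPoint s w z) (cantorPoint s w' z') := by
  rw [dist_eq_norm]
  refine le_trans ?_ (PiLp.norm_apply_le _ j)
  rw [cantorPoint_sub_apply hs0 hs2, Real.norm_eq_abs]
  exact le_abs_tsum_mul_pow (fun i => abs_digit_sub_le _ _ _ _)
    (fun i hi => by rw [hw i hi, hz i hi, sub_self]) (one_le_abs_digit_sub h) hs0
    (by linarith) hs2

theorem continuous_cantorPoint (hs0 : 0 ≤ s) (hs2 : s ≤ 1 / 2) (z : ℕ → Bool) :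
    Continuous fun w : ℕ → Fin n → Fin M => cantorPoint s w z := by
  refine (PiLp.continuous_toLp 2 _).comp (continuous_pi fun j => ?_)
  refine continuous_tsum (u := fun k => 2 * M * s ^ k) (fun k => ?_)
    ((summable_geometric_of_lt_one hs0 (by linarith)).mul_left _) fun k w => ?_
  · have : Continuous fun w : ℕ → Fin n → Fin M => ((w k j : ℕ) : ℝ) :=
      (continuous_of_discreteTopology (f := fun a : Fin M => ((a : ℕ) : ℝ))).comp
        ((continuous_apply j).comp (continuous_apply k))
    fun_prop
  · rw [Real.norm_eq_abs, abs_mul, abs_of_nonneg (pow_nonneg hs0 k)]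
    exact mul_le_mul_of_nonneg_right (abs_digit_le _ _) (pow_nonneg hs0 k)

/-- The Cantor set of the points with a fixed sequence of parities of digits. -/
def cantorSet (n M : ℕ) (s : ℝ) (z : ℕ → Bool) : Set (EuclideanSpace ℝ (Fin n)) :=
  range fun w : ℕ → Fin n → Fin M => cantorPoint s w z

theorem measurableSet_cantorSet (hs0 : 0 ≤ s) (hs2 : s ≤ 1 / 2) (z : ℕ → Bool) :
    MeasurableSet (cantorSet n M s z) :=
  (isCompact_range (continuous_cantorPoint hs0 hs2 z)).isClosed.measurableSet

theorem disjoint_cantorSet (hn : 0 < n) (hs0 : 0 < s) (hs2 : s ≤ 1 / 2) (hs : 8 * M * s ≤ 1)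
    {z z' : ℕ → Bool} (hz : z ≠ z') : Disjoint (cantorSet n M s z) (cantorSet n M s z') := by
  classical
  rw [Set.disjoint_left]
  rintro _ ⟨w, rfl⟩ ⟨w', hw'⟩
  -- The first place where either sequence differs already separates the two points.
  have hex : ∃ k, w k ≠ w' k ∨ z k ≠ z' k := by
    obtain ⟨k, hk⟩ := Function.ne_iff.1 hz
    exact ⟨k, Or.inr hk⟩
  have hmin : ∀ i < Nat.find hex, w i = w' i ∧ z i = z' i := fun i hi => by
    simpa using Nat.find_min hex hi
  obtain ⟨j, hj⟩ : ∃ j, w (Nat.find hex) j ≠ w' (Nat.find hex) j ∨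
      z (Nat.find hex) ≠ z' (Nat.find hex) := by
    rcases Nat.find_spec hex with h | h
    · obtain ⟨j, hj⟩ := Function.ne_iff.1 h
      exact ⟨j, Or.inl hj⟩
    · exact ⟨⟨0, hn⟩, Or.inr h⟩
  have := le_dist_cantorPoint hs0.le hs2 hs (fun i hi => (hmin i hi).1)
    (fun i hi => (hmin i hi).2) hj
  have hd : dist (cantorPoint s w z) (cantorPoint s w' z') = 0 := by
    rw [dist_eq_zero]; exact hw'.symm
  have := pow_pos hs0 (Nat.find hex)
  linarith

/-- The `M ^ (n * k)` cylinders of depth `k` have diameter at most `K * s ^ k`; since `M ^ n * s ^ r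
= 1`, their `r`-sums stay below `K ^ r`. -/
theorem hausdorffMeasure_cantorSet_lt_top {r : ℝ} (hr : 0 < r) (hs0 : 0 < s) (hs2 : s ≤ 1 / 2)
    (hsr : (M : ℝ) ^ n * s ^ r = 1) (z : ℕ → Bool) : μH[r] (cantorSet n M s z) < ∞ := by
  set K : ℝ := n * (4 * M) with hK
  have hK0 : 0 ≤ K := by positivity
  let t : ∀ k : ℕ, (Fin k → Fin n → Fin M) → Set (EuclideanSpace ℝ (Fin n)) := fun k v =>
    (fun w => cantorPoint s w z) '' {w : ℕ → Fin n → Fin M | ∀ i : Fin k, w i = v i}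
  have hdiam : ∀ k v, Metric.ediam (t k v) ≤ ENNReal.ofReal (K * s ^ k) := by
    intro k v
    refine Metric.ediam_le ?_
    rintro _ ⟨w, hw, rfl⟩ _ ⟨w', hw', rfl⟩
    rw [edist_dist]
    exact ENNReal.ofReal_le_ofReal (dist_cantorPoint_le hs0.le hs2 fun i hi =>
      (hw ⟨i, hi⟩).trans (hw' ⟨i, hi⟩).symm)
  have hle := Measure.hausdorffMeasure_le_liminf_sum r (cantorSet n M s z) (l := atTop)
    (fun k => ENNReal.ofReal (K * s ^ k)) (by
      have := ((tendsto_pow_atTop_nhds_zero_of_lt_one hs0.le (by linarith : s < 1)).const_mul K)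
      rw [mul_zero] at this
      simpa using ENNReal.tendsto_ofReal this) t (Eventually.of_forall hdiam)
    (Eventually.of_forall fun k => by
      rintro _ ⟨w, rfl⟩
      exact mem_iUnion.2 ⟨fun i => w i, w, fun i => rfl, rfl⟩)
  refine hle.trans_lt ?_
  have hbound : ∀ k, ∑ v, Metric.ediam (t k v) ^ r ≤ ENNReal.ofReal (K ^ r) := by
    intro k
    calc ∑ v, Metric.ediam (t k v) ^ r
        ≤ ∑ _v : Fin k → Fin n → Fin M, ENNReal.ofReal ((K * s ^ k) ^ r) := by
          refine Finset.sum_le_sum fun v _ => ?_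
          rw [← ENNReal.ofReal_rpow_of_nonneg (by positivity) hr.le]
          exact ENNReal.rpow_le_rpow (hdiam k v) hr.le
      _ = ENNReal.ofReal (((M : ℝ) ^ n) ^ k * (K * s ^ k) ^ r) := by
          rw [Finset.sum_const, nsmul_eq_mul, ENNReal.ofReal_mul (by positivity)]
          congr 1
          simp [ENNReal.ofReal_pow]
      _ = ENNReal.ofReal (K ^ r) := by
          congr 1
          rw [Real.mul_rpow hK0 (by positivity), ← Real.rpow_natCast s k, ← Real.rpow_mul hs0.le,
            mul_comm (k : ℝ) r, Real.rpow_mul hs0.le, Real.rpow_natCast, mul_left_comm, ← mul_pow,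
            hsr, one_pow, mul_one]
  refine lt_of_le_of_lt (liminf_le_of_frequently_le' (Frequently.of_forall hbound))
    ENNReal.ofReal_lt_top

/-- Reading `w` as an expansion in base `M ^ n` maps the Cantor set onto a set containing `[0, 1]`.
The map is `r`-Hölder because `(M ^ n)⁻¹ = s ^ r`, so a null Cantor set would make `[0, 1]` null. -/
theorem hausdorffMeasure_cantorSet_pos {r : ℝ} (hr : 0 < r) (hMn : 1 < M ^ n) (hs0 : 0 < s)
    (hs2 : s ≤ 1 / 2) (hs : 8 * M * s ≤ 1) (hsr : (M : ℝ) ^ n * s ^ r = 1) (z : ℕ → Bool) :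
    0 < μH[r] (cantorSet n M s z) := by
  classical
  lift r to NNReal using hr.le
  have : Nonempty (ℕ → Fin n → Fin M) :=
    ⟨fun _ => finFunctionFinEquiv.symm ⟨0, by omega⟩⟩
  let code : (ℕ → Fin n → Fin M) → ℝ := fun w => Real.ofDigits fun k => finFunctionFinEquiv (w k)
  have hcode : ∀ w w', |code w - code w'| ≤
      (2 * dist (cantorPoint s w z) (cantorPoint s w' z)) ^ (r : ℝ) := by
    intro w w'
    by_cases hw : w = w'
    · subst hw
      simp only [sub_self, abs_zero]
      positivity
    · have hex : ∃ k, w k ≠ w' k := Function.ne_iff.1 hw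
      have hmin : ∀ i < Nat.find hex, w i = w' i := fun i hi => by
        simpa using Nat.find_min hex hi
      obtain ⟨j, hj⟩ := Function.ne_iff.1 (Nat.find_spec hex)
      have h1 := le_dist_cantorPoint hs0.le hs2 hs hmin (z := z) (fun i _ => rfl) (Or.inl hj)
      have h2 : |code w - code w'| ≤ (((M ^ n : ℕ) : ℝ) ^ Nat.find hex)⁻¹ :=
        Real.abs_ofDigits_sub_ofDigits_le fun i hi => by rw [hmin i hi]
      have hM : (((M ^ n : ℕ) : ℝ))⁻¹ = s ^ (r : ℝ) := by
        push_cast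
        exact inv_eq_of_mul_eq_one_right hsr
      refine h2.trans ?_
      rw [← inv_pow, hM, ← Real.rpow_natCast, ← Real.rpow_mul hs0.le, mul_comm (r : ℝ),
        Real.rpow_mul hs0.le, Real.rpow_natCast]
      exact Real.rpow_le_rpow (by positivity) (by linarith) hr.le
  let g : EuclideanSpace ℝ (Fin n) → ℝ := fun x =>
    code (Function.invFun (fun w => cantorPoint s w z) x)
  have hinv : ∀ x ∈ cantorSet n M s z,
      cantorPoint s (Function.invFun (fun w : ℕ → Fin n → Fin M => cantorPoint s w z) x) z = x :=
    fun x hx => Function.invFun_eq (f := fun w : ℕ → Fin n → Fin M => cantorPoint s w z) hx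
  have hholder : HolderOnWith (2 ^ (r : ℝ)) r g (cantorSet n M s z) := by
    intro x hx y hy
    have h := hcode (Function.invFun (fun w => cantorPoint s w z) x)
      (Function.invFun (fun w => cantorPoint s w z) y)
    rw [hinv x hx, hinv y hy, Real.mul_rpow (by norm_num) dist_nonneg] at h
    have h' := ENNReal.ofReal_le_ofReal h
    rw [ENNReal.ofReal_mul (by positivity), ← ENNReal.ofReal_rpow_of_nonneg dist_nonneg hr.le,
      ← edist_dist] at h'
    rw [edist_dist, Real.dist_eq]
    refine h'.trans (le_of_eq ?_)
    congr 1
    rw [← ENNReal.ofReal_rpow_of_nonneg (by norm_num) hr.le, ENNReal.coe_rpow_of_nonneg _ hr.le]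
    simp
  have himage : Icc (0 : ℝ) 1 ⊆ g '' cantorSet n M s z := by
    intro y hy
    obtain ⟨d, -, hd⟩ := Real.ofDigits_SurjOn hMn hy
    refine ⟨cantorPoint s (fun k => finFunctionFinEquiv.symm (d k)) z, ⟨_, rfl⟩, ?_⟩
    -- Whatever preimage `invFun` selects, `hcode` at distance zero forces the same code.
    have h0 := hcode (Function.invFun (fun w => cantorPoint s w z)
      (cantorPoint s (fun k => finFunctionFinEquiv.symm (d k)) z))
      (fun k => finFunctionFinEquiv.symm (d k))
    rw [hinv _ ⟨_, rfl⟩, dist_self, mul_zero, Real.zero_rpow hr.ne'] at h0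
    have h1 := sub_eq_zero.1 (abs_nonpos_iff.1 h0)
    refine h1.trans ?_
    simpa [code] using hd
  have h1 := hholder.hausdorffMeasure_image_le (d := 1) (by exact_mod_cast hr) zero_le_one
  have h2 : (1 : ℝ≥0∞) ≤ μH[1] (g '' cantorSet n M s z) := by
    refine le_trans ?_ (measure_mono himage)
    rw [hausdorffMeasure_real, Real.volume_Icc]
    simp
  rw [pos_iff_ne_zero]
  intro h0
  have h3 := h2.trans h1
  rw [mul_one, h0, mul_zero] at h3
  exact absurd h3 (by simp)

end cantorPoint

theorem exists_disjoint_family_hausdorffMeasure_pos_finite {n : ℕ} {r : ℝ} (hr : 0 < r)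
    (hrn : r < n) : ∃ C : (ℕ → Bool) → Set (EuclideanSpace ℝ (Fin n)),
      (∀ z, MeasurableSet (C z)) ∧ Pairwise (Function.onFun Disjoint C) ∧
      (∀ z, 0 < μH[r] (C z)) ∧ ∀ z, μH[r] (C z) < ∞ := by
  have hn : 0 < n := by
    have : (0 : ℝ) < n := hr.trans hrn
    exact_mod_cast this
  -- With `s = M ^ (-(n / r))`, `M * s` is this power, which tends to zero because `r < n`.
  have hlim : Tendsto (fun M : ℕ => (M : ℝ) ^ (-(n / r - 1))) atTop (𝓝 0) :=
    (tendsto_rpow_neg_atTop (by rw [sub_pos, one_lt_div hr]; exact hrn)).comp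
      tendsto_natCast_atTop_atTop
  obtain ⟨M, hM8, hM2⟩ := ((hlim.eventually_le_const (show (0 : ℝ) < 1 / 8 by norm_num)).and
    (eventually_ge_atTop 2)).exists
  have hM0 : (0 : ℝ) < M := by positivity
  set s : ℝ := (M : ℝ) ^ (-(n / r)) with hs
  have hs0 : 0 < s := Real.rpow_pos_of_pos hM0 _
  have hs8 : 8 * M * s ≤ 1 := by
    have : (M : ℝ) * s = (M : ℝ) ^ (-(n / r - 1)) := by
      rw [hs, neg_sub, sub_eq_add_neg, Real.rpow_add hM0, Real.rpow_one]
    rw [mul_assoc, this]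
    linarith
  have hM2' : (2 : ℝ) ≤ M := by exact_mod_cast hM2
  have hs2 : s ≤ 1 / 2 := by nlinarith
  have hsr : (M : ℝ) ^ n * s ^ r = 1 := by
    rw [hs, ← Real.rpow_mul hM0.le, neg_mul, div_mul_cancel₀ _ hr.ne', Real.rpow_neg hM0.le,
      Real.rpow_natCast, mul_inv_cancel₀ (by positivity)]
  exact ⟨cantorSet n M s, measurableSet_cantorSet hs0.le hs2,
    fun _ _ h => disjoint_cantorSet hn hs0 hs2 hs8 h,
    hausdorffMeasure_cantorSet_pos hr (Nat.one_lt_pow hn.ne' hM2) hs0 hs2 hs8 hsr,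
    hausdorffMeasure_cantorSet_lt_top hr hs0 hs2 hsr⟩

/-! ### Transport of atomless measures. -/

section map

open ProbabilityTheory unitInterval

theorem continuous_cdf {ν : Measure ℝ} [IsProbabilityMeasure ν] (h : ∀ x, ν {x} = 0) :
    Continuous (cdf ν) := by
  refine continuous_iff_continuousAt.2 fun x => ?_
  rw [continuousAt_iff_continuous_left'_right']
  refine ⟨?_, continuousWithinAt_Ioi_iff_Ici.2 ((cdf ν).right_continuous x)⟩
  rw [(monotone_cdf ν).continuousWithinAt_Iio_iff_leftLim_eq]
  have h1 := (cdf ν).measure_singleton x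
  rw [measure_cdf, h x, eq_comm, ENNReal.ofReal_eq_zero, sub_nonpos] at h1
  exact le_antisymm ((monotone_cdf ν).leftLim_le le_rfl) h1

theorem exists_cdf_eq {ν : Measure ℝ} [IsProbabilityMeasure ν] (h : ∀ x, ν {x} = 0) {b : ℝ}
    (hb : b ∈ Ioo (0 : ℝ) 1) : ∃ x, cdf ν x = b := by
  refine mem_range_of_exists_le_of_exists_ge (continuous_cdf h) ?_ ?_
  · exact ((tendsto_cdf_atBot ν).eventually_le_const hb.1).exists
  · exact ((tendsto_cdf_atTop ν).eventually_const_le hb.2).exists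

theorem measure_cdf_le {ν : Measure ℝ} [IsProbabilityMeasure ν] (h : ∀ x, ν {x} = 0) {a : ℝ}
    (ha : a ∈ Icc (0 : ℝ) 1) : ν {x | cdf ν x ≤ a} = ENNReal.ofReal a := by
  refine le_antisymm ?_ ?_
  -- The cdf may be constant at level `a`, so the sublevel set is bounded by a point of level `a +
  -- ε`.
  · refine ENNReal.le_of_forall_pos_le_add fun ε hε _ => ?_
    have hε' : (0 : ℝ) < ε := hε
    rw [← ENNReal.ofReal_coe_nnreal, ← ENNReal.ofReal_add ha.1 hε'.le]
    rcases lt_or_ge (a + ε) 1 with h1 | h1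
    · obtain ⟨y, hy⟩ := exists_cdf_eq h (b := a + ε) ⟨by linarith [ha.1], h1⟩
      rw [← hy, ofReal_cdf]
      refine measure_mono fun x hx => ?_
      by_contra hxy
      have hx' : cdf ν x ≤ a := hx
      have := monotone_cdf ν (not_le.1 hxy).le
      linarith
    · exact prob_le_one.trans (by simpa using ENNReal.ofReal_le_ofReal h1)
  · rcases ha.1.eq_or_lt with h0 | h0
    · simp [← h0]
    rcases ha.2.eq_or_lt with h1 | h1
    · have : {x | cdf ν x ≤ a} = univ := eq_univ_of_forall fun x => h1 ▸ cdf_le_one ν x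
      rw [this, measure_univ, h1, ENNReal.ofReal_one]
    · obtain ⟨y, hy⟩ := exists_cdf_eq h ⟨h0, h1⟩
      rw [← hy, ofReal_cdf]
      exact measure_mono fun x hx => monotone_cdf ν hx

theorem exists_measurable_map_eq_volume_unitInterval {ν : Measure ℝ} [IsProbabilityMeasure ν]
    (h : ∀ x, ν {x} = 0) : ∃ f : ℝ → I, Measurable f ∧ ν.map f = volume := by
  have hm : Measurable fun x => (⟨cdf ν x, cdf_nonneg ν x, cdf_le_one ν x⟩ : I) :=
    (monotone_cdf ν).measurable.subtype_mk
  refine ⟨_, hm, ?_⟩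
  have := Measure.isProbabilityMeasure_map (μ := ν) hm.aemeasurable
  refine Measure.ext_of_Iic _ _ fun a => ?_
  rw [Measure.map_apply hm measurableSet_Iic, unitInterval.volume_Iic]
  exact measure_cdf_le h a.2

/-- Embed `X` in the line, apply the cdf to get the uniform law on `[0, 1]`, then realise `ν` as an
image of that law. -/
theorem exists_measurePreserving_of_prob {X Y : Type*} [MeasurableSpace X] [StandardBorelSpace X]
    [MeasurableSpace Y] [StandardBorelSpace Y] {μ : Measure X} [IsProbabilityMeasure μ]
    (h : ∀ x, μ {x} = 0) (ν : Measure Y) [IsProbabilityMeasure ν] :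
    ∃ f : X → Y, MeasurePreserving f μ ν := by
  have : Nonempty Y := nonempty_of_isProbabilityMeasure ν
  have he := measurableEmbedding_embeddingReal X
  have hp := Measure.isProbabilityMeasure_map (μ := μ) he.measurable.aemeasurable
  obtain ⟨f, hf, hfν⟩ := exists_measurable_map_eq_volume_unitInterval
    (ν := μ.map (embeddingReal X)) fun y => by
      rw [he.map_apply]
      rcases (subsingleton_singleton.preimage he.injective).eq_empty_or_singleton with h0 | ⟨x, hx⟩
      · exact (congrArg μ h0).trans measure_empty
      · exact (congrArg μ hx).trans (h x)
  obtain ⟨g, hg, hgν⟩ := Measure.exists_measurable_map_eq ν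
  exact ⟨g ∘ f ∘ embeddingReal X, (MeasurePreserving.mk hg hgν).comp
    ((MeasurePreserving.mk hf hfν).comp ⟨he.measurable, rfl⟩)⟩

theorem exists_quasiMeasurePreserving {X Y : Type*} [MeasurableSpace X] [StandardBorelSpace X]
    [MeasurableSpace Y] [StandardBorelSpace Y] {μ : Measure X} [IsFiniteMeasure μ]
    (h : ∀ x, μ {x} = 0) (ν : Measure Y) [SigmaFinite ν] [NeZero ν] :
    ∃ f : X → Y, Measure.QuasiMeasurePreserving f μ ν := by
  rcases eq_or_ne μ 0 with rfl | hμ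
  · obtain ⟨y, -⟩ := nonempty_of_measure_ne_zero (NeZero.ne (ν univ))
    exact ⟨fun _ => y, measurable_const, by simp⟩
  have : NeZero μ := ⟨hμ⟩
  obtain ⟨f, hf⟩ := exists_measurePreserving_of_prob (μ := (μ univ)⁻¹ • μ)
    (fun x => by simp [h x]) ν.toFinite
  refine ⟨f, hf.measurable, ?_⟩
  have h1 : μ ≪ (μ univ)⁻¹ • μ :=
    Measure.absolutelyContinuous_smul (ENNReal.inv_ne_zero.2 (measure_ne_top μ univ))
  refine (h1.map hf.measurable).trans ?_
  rw [hf.map_eq]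
  exact toFinite_absolutelyContinuous ν

end map

/-! ### Measure-theoretic properties of the σ-finite ideal. -/

section ideals

variable {n : ℕ} {r : ℝ}

theorem iUnion_mem_sigmaFinIdeal {A : ℕ → Set (EuclideanSpace ℝ (Fin n))}
    (hA : ∀ k, A k ∈ sigmaFinIdeal n r) : ⋃ k, A k ∈ sigmaFinIdeal n r := by
  choose S hS hfin using hA
  refine ⟨fun k => S k.unpair.1 k.unpair.2, ?_, fun k => hfin _ _⟩
  rw [Set.iUnion_unpair (f := S)]
  exact iUnion_congr hS

theorem mem_sigmaFinIdeal_of_lt_top {A : Set (EuclideanSpace ℝ (Fin n))} (hA : μH[r] A < ∞) :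
    A ∈ sigmaFinIdeal n r :=
  ⟨fun _ => A, iUnion_const A, fun _ => hA⟩

theorem sUnion_mem_sigmaFinIdeal {F : Set (Set (EuclideanSpace ℝ (Fin n)))} (hF : F.Countable)
    (hFI : F ⊆ sigmaFinIdeal n r) : ⋃₀ F ∈ sigmaFinIdeal n r := by
  rcases F.eq_empty_or_nonempty with rfl | hne
  · rw [sUnion_empty]
    exact mem_sigmaFinIdeal_of_lt_top (by simp)
  · obtain ⟨A, rfl⟩ := hF.exists_eq_range hne
    rw [sUnion_range]
    exact iUnion_mem_sigmaFinIdeal fun k => hFI (mem_range_self k)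

theorem exists_measurable_cover {A : Set (EuclideanSpace ℝ (Fin n))}
    (hA : A ∈ sigmaFinIdeal n r) : ∃ B : ℕ → Set (EuclideanSpace ℝ (Fin n)),
      A ⊆ ⋃ k, B k ∧ (∀ k, MeasurableSet (B k)) ∧ ∀ k, μH[r] (B k) < ∞ := by
  obtain ⟨S, rfl, hfin⟩ := hA
  exact ⟨fun k => toMeasurable μH[r] (S k), iUnion_mono fun k => subset_toMeasurable _ _,
    fun k => measurableSet_toMeasurable _ _, fun k => (measure_toMeasurable _).trans_lt (hfin k)⟩

theorem hausdorffMeasure_eq_zero_iff_volume {A : Set (EuclideanSpace ℝ (Fin n))} :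
    μH[(n : ℝ)] A = 0 ↔ volume A = 0 := by
  have h : (μH[(n : ℝ)] : Measure (EuclideanSpace ℝ (Fin n))).IsAddHaarMeasure := by
    simpa using isAddHaarMeasure_hausdorffMeasure (E := EuclideanSpace ℝ (Fin n))
  exact ⟨fun h0 => Measure.absolutelyContinuous_isAddHaarMeasure volume μH[(n : ℝ)] h0,
    fun h0 => Measure.absolutelyContinuous_isAddHaarMeasure μH[(n : ℝ)] volume h0⟩

theorem volume_eq_zero_of_mem_sigmaFinIdeal (hrn : r < n) {A : Set (EuclideanSpace ℝ (Fin n))}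
    (hA : A ∈ sigmaFinIdeal n r) : volume A = 0 := by
  obtain ⟨S, rfl, hfin⟩ := hA
  exact measure_iUnion_null fun k => hausdorffMeasure_eq_zero_iff_volume.1
    ((Measure.hausdorffMeasure_zero_or_top hrn (S k)).resolve_right (hfin k).ne)

/-- Each finite-measure piece of a cover of `A` meets only countably many `C z` in positive measure,
and every `C z ⊆ A` meets some piece so. -/
theorem countable_setOf_subset {ι : Type*} {C : ι → Set (EuclideanSpace ℝ (Fin n))}
    (hm : ∀ z, MeasurableSet (C z)) (hd : Pairwise (Function.onFun Disjoint C))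
    (hpos : ∀ z, 0 < μH[r] (C z)) {A : Set (EuclideanSpace ℝ (Fin n))}
    (hA : A ∈ sigmaFinIdeal n r) : {z | C z ⊆ A}.Countable := by
  obtain ⟨B, hAB, -, hfin⟩ := exists_measurable_cover hA
  have hcount : ∀ k, {z | 0 < (μH[r].restrict (B k)) (C z)}.Countable := fun k => by
    have : IsFiniteMeasure ((μH[r] : Measure (EuclideanSpace ℝ (Fin n))).restrict (B k)) :=
      isFiniteMeasure_restrict.2 (hfin k).ne
    exact Measure.countable_meas_pos_of_disjoint_iUnion hm hd
  refine (countable_iUnion hcount).mono fun z hz => ?_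
  by_contra hcon
  have h0 : ∀ k, μH[r] (C z ∩ B k) = 0 := fun k => by
    have h := fun h => hcon (mem_iUnion.2 ⟨k, h⟩)
    simpa [Measure.restrict_apply (hm z)] using h
  have h1 := measure_iUnion_null h0
  rw [← inter_iUnion, inter_eq_left.2 (hz.trans hAB)] at h1
  exact (hpos z).ne' h1

theorem exists_quasiMeasurePreserving_restrict (hr : 0 < r)
    {B : Set (EuclideanSpace ℝ (Fin n))} (hB : μH[r] B < ∞) :
    ∃ f : EuclideanSpace ℝ (Fin n) → EuclideanSpace ℝ (Fin n),
      Measure.QuasiMeasurePreserving f (μH[r].restrict B) volume := by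
  have := Measure.nullSingletonClass_hausdorff (X := EuclideanSpace ℝ (Fin n)) hr
  have : IsFiniteMeasure ((μH[r] : Measure (EuclideanSpace ℝ (Fin n))).restrict B) :=
    isFiniteMeasure_restrict.2 hB.ne
  exact exists_quasiMeasurePreserving (fun x =>
    Measure.absolutelyContinuous_of_le Measure.restrict_le_self (measure_singleton x)) volume

end ideals

/-! ### The four cardinal invariants. -/

section invariants

variable {n : ℕ} {r : ℝ}

theorem exists_add_eq {X : Type} {I : Set (Set X)} (h : ∃ F ⊆ I, ⋃₀ F ∉ I) :
    ∃ F ⊆ I, ⋃₀ F ∉ I ∧ #F = add I := by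
  obtain ⟨F, hF⟩ := h
  exact csInf_mem (s := {κ | ∃ F : Set (Set X), F ⊆ I ∧ ⋃₀ F ∉ I ∧ #F = κ})
    ⟨#F, F, hF.1, hF.2, rfl⟩

theorem exists_cov_eq {X : Type} {I : Set (Set X)} (h : ∀ x, {x} ∈ I) :
    ∃ F ⊆ I, ⋃₀ F = univ ∧ #F = cov I := by
  refine csInf_mem (s := {κ | ∃ F : Set (Set X), F ⊆ I ∧ ⋃₀ F = univ ∧ #F = κ})
    ⟨_, range fun x : X => {x}, ?_, ?_, rfl⟩
  · rintro _ ⟨x, rfl⟩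
    exact h x
  · exact eq_univ_of_forall fun x => ⟨{x}, mem_range_self x, rfl⟩

theorem exists_non_eq {X : Type} {I : Set (Set X)} (h : univ ∉ I) :
    ∃ A ∉ I, #A = non I :=
  csInf_mem (s := {κ | ∃ A : Set X, A ∉ I ∧ #A = κ}) ⟨_, univ, h, rfl⟩

theorem add_le {X : Type} {I F : Set (Set X)} (hF : F ⊆ I) (hU : ⋃₀ F ∉ I) : add I ≤ #F :=
  csInf_le' ⟨F, hF, hU, rfl⟩

theorem cov_le {X : Type} {I F : Set (Set X)} (hF : F ⊆ I) (hU : ⋃₀ F = univ) : cov I ≤ #F :=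
  csInf_le' ⟨F, hF, hU, rfl⟩

theorem non_le {X : Type} {I : Set (Set X)} {A : Set X} (hA : A ∉ I) : non I ≤ #A :=
  csInf_le' ⟨A, hA, rfl⟩

theorem add_sigmaFinIdeal (hr : 0 < r) (hrn : r < n) : add (sigmaFinIdeal n r) = ℵ₁ := by
  obtain ⟨C, hm, hd, hpos, hfin⟩ := exists_disjoint_family_hausdorffMeasure_pos_finite hr hrn
  obtain ⟨Z, hZ⟩ : ∃ Z : Set (ℕ → Bool), #Z = ℵ₁ := by
    refine Cardinal.le_mk_iff_exists_set.1 ?_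
    simpa using Cardinal.aleph_one_le_continuum
  have hsub : C '' Z ⊆ sigmaFinIdeal n r := by
    rintro _ ⟨z, -, rfl⟩
    exact mem_sigmaFinIdeal_of_lt_top (hfin z)
  have hnot : ⋃₀ (C '' Z) ∉ sigmaFinIdeal n r := fun hmem => by
    have hc := (countable_setOf_subset hm hd hpos hmem).mono
      (show Z ⊆ _ from fun z hz => subset_sUnion_of_mem (mem_image_of_mem C hz))
    rw [← Cardinal.le_aleph0_iff_set_countable, hZ] at hc
    exact hc.not_gt Cardinal.aleph0_lt_aleph_one
  refine le_antisymm (((add_le hsub hnot).trans Cardinal.mk_image_le).trans hZ.le) ?_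
  obtain ⟨F, hF, hFn, hcard⟩ := exists_add_eq ⟨_, hsub, hnot⟩
  rw [← hcard, ← Cardinal.succ_aleph0, Order.succ_le_iff, ← not_le,
    Cardinal.le_aleph0_iff_set_countable]
  exact fun hc => hFn (sUnion_mem_sigmaFinIdeal hc hF)

theorem cov_sigmaFinIdeal (hr : 0 < r) (hrn : r < n) :
    cov (sigmaFinIdeal n r) = cov (nullIdeal n r) := by
  refine le_antisymm ?_ ?_
  · obtain ⟨F, hF, hU, hcard⟩ := exists_cov_eq (singleton_mem_nullIdeal n hr)
    rw [← hcard]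
    exact cov_le (hF.trans (nullIdeal_subset_sigmaFinIdeal n r)) hU
  · obtain ⟨F, hF, hU, hcard⟩ := exists_cov_eq fun x =>
      nullIdeal_subset_sigmaFinIdeal n r (singleton_mem_nullIdeal n hr x)
    -- Infinitude makes the index set `F × ℕ × F` no larger than `F`.
    have hinf : ℵ₀ ≤ #F := by
      by_contra hlt
      have hc := Cardinal.le_aleph0_iff_set_countable.1 (not_le.1 hlt).le
      exact univ_notMem_sigmaFinIdeal hrn (hU ▸ sUnion_mem_sigmaFinIdeal hc hF)
    choose B hcover hBm hBfin using fun H : F => exists_measurable_cover (hF H.2)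
    choose f hf using fun (H : F) (k : ℕ) => exists_quasiMeasurePreserving_restrict hr (hBfin H k)
    -- Each piece `B H k` is covered by the preimages of the members of `F` themselves.
    let P : F × ℕ × F → Set (EuclideanSpace ℝ (Fin n)) := fun p =>
      f p.1 p.2.1 ⁻¹' (p.2.2 : Set _) ∩ B p.1 p.2.1
    have hP : range P ⊆ nullIdeal n r := by
      rintro _ ⟨⟨H, k, G⟩, rfl⟩
      have h0 := (hf H k).preimage_null (volume_eq_zero_of_mem_sigmaFinIdeal hrn (hF G.2))
      rwa [Measure.restrict_apply' (hBm H k)] at h0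
    have hPU : ⋃₀ range P = univ := by
      refine eq_univ_of_forall fun x => ?_
      obtain ⟨H, hH, hxH⟩ : x ∈ ⋃₀ F := hU ▸ mem_univ x
      obtain ⟨k, hk⟩ := mem_iUnion.1 (hcover ⟨H, hH⟩ hxH)
      obtain ⟨G, hG, hxG⟩ : f ⟨H, hH⟩ k x ∈ ⋃₀ F := hU ▸ mem_univ _
      exact ⟨_, ⟨(⟨H, hH⟩, k, ⟨G, hG⟩), rfl⟩, hxG, hk⟩
    rw [← hcard]
    refine (cov_le hP hPU).trans (Cardinal.mk_range_le.trans ?_)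
    simp only [Cardinal.mk_prod, Cardinal.lift_id, Cardinal.mk_nat]
    rw [Cardinal.aleph0_mul_eq hinf, Cardinal.mul_eq_self hinf]

theorem non_sigmaFinIdeal (hr : 0 < r) (hrn : r < n) :
    non (sigmaFinIdeal n r) = non (nullIdeal n r) := by
  have huniv := univ_notMem_sigmaFinIdeal hrn
  have hsub := nullIdeal_subset_sigmaFinIdeal n r
  refine le_antisymm ?_ ?_
  · obtain ⟨A, hA, hcard⟩ := exists_non_eq fun h => huniv (hsub h)
    rw [← hcard]
    by_cases hAI : A ∈ sigmaFinIdeal n r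
    · obtain ⟨B, hAB, hBm, hBfin⟩ := exists_measurable_cover hAI
      obtain ⟨k, hk⟩ : ∃ k, μH[r] (A ∩ B k) ≠ 0 := by
        by_contra! h0
        have h1 := measure_iUnion_null h0
        rw [← inter_iUnion, inter_eq_left.2 hAB] at h1
        exact hA h1
      obtain ⟨f, hf⟩ := exists_quasiMeasurePreserving_restrict hr (hBfin k)
      -- The witness is `f '' A`: were it σ-finite, it would be Lebesgue null and `A ∩ B k` would be
      -- `μH[r]`-null.
      refine (non_le fun hmem => hk ?_).trans (Cardinal.mk_image_le (f := f) (s := A))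
      have h0 := hf.preimage_null (volume_eq_zero_of_mem_sigmaFinIdeal hrn hmem)
      rw [Measure.restrict_apply' (hBm k)] at h0
      exact measure_mono_null (inter_subset_inter_left _ (subset_preimage_image f A)) h0
    · exact non_le hAI
  · obtain ⟨A, hA, hcard⟩ := exists_non_eq huniv
    rw [← hcard]
    exact non_le fun h => hA (hsub h)

theorem cof_sigmaFinIdeal (hr : 0 < r) (hrn : r < n) : cof (sigmaFinIdeal n r) = 𝔠 := by
  refine le_antisymm ?_ ?_
  · let s : Set (sigmaFinIdeal n r) := {A | MeasurableSet (A : Set (EuclideanSpace ℝ (Fin n)))}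
    have hs : IsCofinal s := by
      rintro ⟨A, hA⟩
      obtain ⟨B, hAB, hBm, hBfin⟩ := exists_measurable_cover hA
      exact ⟨⟨⋃ k, B k, iUnion_mem_sigmaFinIdeal fun k => mem_sigmaFinIdeal_of_lt_top (hBfin k)⟩,
        MeasurableSet.iUnion hBm, hAB⟩
    refine (Order.cof_le hs).trans ?_
    have hle : #s ≤ #{A : Set (EuclideanSpace ℝ (Fin n)) | MeasurableSet A} :=
      Cardinal.mk_le_of_injective (f := fun A : s => ⟨(A : sigmaFinIdeal n r), A.2⟩)
        fun A A' h => Subtype.ext (Subtype.ext (Subtype.mk.inj h))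
    refine hle.trans ?_
    rw [BorelSpace.measurable_eq (α := EuclideanSpace ℝ (Fin n)),
      (TopologicalSpace.isBasis_countableBasis _).borel_eq_generateFrom]
    refine MeasurableSpace.cardinal_measurableSet_le_continuum ?_
    exact (Cardinal.le_aleph0_iff_set_countable.2
      (TopologicalSpace.countable_countableBasis _)).trans Cardinal.aleph0_le_continuum
  · refine Order.le_cof_iff.2 fun s hs => ?_
    obtain ⟨C, hm, hd, hpos, hfin⟩ := exists_disjoint_family_hausdorffMeasure_pos_finite hr hrn
    choose g hgs hCg using fun z => hs ⟨C z, mem_sigmaFinIdeal_of_lt_top (hfin z)⟩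
    by_contra hlt
    rw [not_le] at hlt
    have hlt' : #s < #(ℕ → Bool) := by simpa using hlt
    have : Uncountable (ℕ → Bool) := by
      rw [← Cardinal.aleph0_lt_mk_iff]
      simpa using Cardinal.aleph0_lt_continuum
    -- With fewer than `𝔠` cofinal sets, one of them would contain uncountably many Cantor sets.
    obtain ⟨A, hA⟩ := Cardinal.exists_uncountable_fiber (fun z => (⟨g z, hgs z⟩ : s)) hlt'
    refine hA.not_countable (Set.countable_coe_iff.2 ?_)
    refine (countable_setOf_subset hm hd hpos A.1.2).mono fun z hz => ?_
    have h1 : g z = A := congrArg Subtype.val hz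
    show C z ⊆ ((A : sigmaFinIdeal n r) : Set (EuclideanSpace ℝ (Fin n)))
    rw [← h1]
    exact hCg z

end invariants

end HausdorffInvariants

theorem mainTheorem7 (n : ℕ) (r : ℝ) (hr : 0 < r) (hrn : r < (n : ℝ)) :
    HausdorffInvariants.add (HausdorffInvariants.sigmaFinIdeal n r) = ℵ₁ ∧
    HausdorffInvariants.cov (HausdorffInvariants.sigmaFinIdeal n r) =
      HausdorffInvariants.cov (HausdorffInvariants.nullIdeal n r) ∧
    HausdorffInvariants.non (HausdorffInvariants.sigmaFinIdeal n r) =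
      HausdorffInvariants.non (HausdorffInvariants.nullIdeal n r) ∧
    HausdorffInvariants.cof (HausdorffInvariants.sigmaFinIdeal n r) = 𝔠 :=
  ⟨HausdorffInvariants.add_sigmaFinIdeal hr hrn, HausdorffInvariants.cov_sigmaFinIdeal hr hrn,
    HausdorffInvariants.non_sigmaFinIdeal hr hrn, HausdorffInvariants.cof_sigmaFinIdeal hr hrn⟩
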